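/- Let $(M,g)$ be a closed (compact, without boundary) smooth Riemannian manifold with Riemannian volume $\mathcal V_g$. Let $\|u\|_{H^1}=\left(\int_M|u|^2\,d\mathcal V_g+\int_M|du|_g^2\,d\mathcal V_g\right)^{1/2}$, where $du$ is the differential in the sense of distributions, and let $H^1(M)$ be the closure of $C^\infty(M)$ for this norm, inside the space of real functions $u\in L^2(M)$ with $du\in L^2(M)$. For a subset $A\subset M$ put $$\mathcal H^1_0(M-A)=\{u\in H^1(M):\ u=0 \text{ almost everywhere on some open neighborhood of } A\}.$$ If $A$ is compact, then the closure of $\mathcal H^1_0(M-A)$ in $H^1(M)$ is equal to the usual space $H^1_0(M-A)$, that is, to the closure in $H^1(M)$ of $C_c^\infty(M-A)$, the smooth functions with compact support contained in $M-A$ (extended by zero to $M$). -/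

import Mathlib

open MeasureTheory Set
open scoped Manifold ContDiff ENNReal

namespace SobolevHoles

/-- A smooth Riemannian metric on a smooth manifold `M` without boundary of dimension `n`. -/
abbrev Metric (n : ℕ) (M : Type*) [TopologicalSpace M]
    [ChartedSpace (EuclideanSpace ℝ (Fin n)) M] [IsManifold (𝓡 n) ∞ M] :=
  Bundle.ContMDiffRiemannianMetric (𝓡 n) ∞ (EuclideanSpace ℝ (Fin n))
    (fun x : M => TangentSpace (𝓡 n) x)

noncomputable section

variable {n : ℕ} {M : Type*} [TopologicalSpace M] [ChartedSpace (EuclideanSpace ℝ (Fin n)) M]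

/-- The `i`-th coordinate vector field `∂/∂xᵢ` of the chart `e`, at the point of `M` whose
coordinates are `y`. -/
def coordVec (e : OpenPartialHomeomorph M (EuclideanSpace ℝ (Fin n)))
    (y : EuclideanSpace ℝ (Fin n)) (i : Fin n) : TangentSpace (𝓡 n) (e.symm y) :=
  mfderiv 𝓘(ℝ, EuclideanSpace ℝ (Fin n)) (𝓡 n) e.symm y (EuclideanSpace.single i (1 : ℝ))

/-- `α` is the differential of `u` in the sense of distributions: in every chart, `u` and the
components of `α` are locally integrable, and the `i`-th component of `α` is the weak `i`-th
partial derivative of `u` (tested against smooth functions compactly supported in the image of the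
chart). -/
def IsWeakDifferential (u : M → ℝ) (α : (x : M) → TangentSpace (𝓡 n) x →L[ℝ] ℝ) : Prop :=
  ∀ e ∈ atlas (EuclideanSpace ℝ (Fin n)) M,
    LocallyIntegrableOn (fun y => u (e.symm y)) e.target volume ∧
    ∀ i : Fin n,
      LocallyIntegrableOn (fun y => α (e.symm y) (coordVec e y i)) e.target volume ∧
      ∀ ψ : EuclideanSpace ℝ (Fin n) → ℝ, ContDiff ℝ ∞ ψ → HasCompactSupport ψ →
        tsupport ψ ⊆ e.target →
        ∫ y in e.target, u (e.symm y) * fderiv ℝ ψ y (EuclideanSpace.single i (1 : ℝ)) =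
          -∫ y in e.target, α (e.symm y) (coordVec e y i) * ψ y

variable [IsManifold (𝓡 n) ∞ M]

/-- The matrix `(g_{ij})` of the metric in the chart `e`, at the coordinates `y`. -/
def gram (g : Metric n M) (e : OpenPartialHomeomorph M (EuclideanSpace ℝ (Fin n)))
    (y : EuclideanSpace ℝ (Fin n)) : Matrix (Fin n) (Fin n) ℝ :=
  Matrix.of fun i j => g.inner (e.symm y) (coordVec e y i) (coordVec e y j)

/-- The measure `√det(g_{ij}) dx` on the domain of the chart `e`. -/
def chartVolume [MeasurableSpace M] (g : Metric n M)
    (e : OpenPartialHomeomorph M (EuclideanSpace ℝ (Fin n))) : Measure M :=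
  ((volume.restrict e.target).withDensity
    (fun y => ENNReal.ofReal (Real.sqrt (gram g e y).det))).map e.symm

/-- The norm `|α|_g` of a covector `α` at `x`: the dual norm of the norm `√g(v, v)`. -/
def coNorm (g : Metric n M) (x : M) (α : TangentSpace (𝓡 n) x →L[ℝ] ℝ) : ℝ≥0∞ :=
  ⨆ (v : TangentSpace (𝓡 n) x) (_ : g.inner x v v ≤ 1), ‖α v‖ₑ

variable [T2Space M] [CompactSpace M]

variable (n M) in
/-- A smooth partition of unity `(ρ_p)` subordinate to the chart domains. -/
def chartPartition : SmoothPartitionOfUnity M (𝓡 n) M univ :=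
  (SmoothPartitionOfUnity.exists_isSubordinate_chartAt_source (𝓡 n) M).choose

variable (n M) in
theorem chartPartition_isSubordinate :
    (chartPartition n M).IsSubordinate
      (fun p => (chartAt (EuclideanSpace ℝ (Fin n)) p).source) :=
  (SmoothPartitionOfUnity.exists_isSubordinate_chartAt_source (𝓡 n) M).choose_spec

variable [MeasurableSpace M] [BorelSpace M]

/-- The Riemannian volume measure: `∫ f dV_g = ∑ₚ ∫ ρ_p f √det(g_{ij}) dx`, the `p`-th integral
being computed in the chart at `p` (only finitely many `ρ_p` are not identically zero). -/
def vol (g : Metric n M) : Measure M :=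
  Measure.sum fun p : M =>
    (chartVolume g (chartAt (EuclideanSpace ℝ (Fin n)) p)).withDensity
      (fun x => ENNReal.ofReal (chartPartition n M p x))

/-- `u ∈ L²(M)` and `du ∈ L²(M)`, where `du` is taken in the sense of distributions. -/
def HasL2Differential (g : Metric n M) (u : M → ℝ) : Prop :=
  MemLp u 2 (vol g) ∧
    ∃ α : (x : M) → TangentSpace (𝓡 n) x →L[ℝ] ℝ,
      IsWeakDifferential u α ∧ ∫⁻ x, coNorm g x (α x) ^ 2 ∂(vol g) < ⊤

/-- The norm `‖u‖_{H¹} = (∫ |u|² dV_g + ∫ |du|² dV_g)^{1/2}`. Since the weak differential `du` is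
unique up to null sets, the infimum is over at most one value; it is `∞` if there is no `du`. -/
def h1Norm (g : Metric n M) (u : M → ℝ) : ℝ≥0∞ :=
  ⨅ (α : (x : M) → TangentSpace (𝓡 n) x →L[ℝ] ℝ) (_ : IsWeakDifferential u α),
    (∫⁻ x, ‖u x‖ₑ ^ 2 ∂(vol g) + ∫⁻ x, coNorm g x (α x) ^ 2 ∂(vol g)) ^ (1 / 2 : ℝ)

/-- The Sobolev space `H¹(M)`: the closure of `C^∞(M)` for the `H¹` norm, among the functions in
`L²` with distributional differential in `L²`. -/
def H1 (g : Metric n M) : Set (M → ℝ) :=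
  {u | HasL2Differential g u ∧ ∀ ε : ℝ≥0∞, 0 < ε →
    ∃ φ : M → ℝ, ContMDiff (𝓡 n) 𝓘(ℝ, ℝ) ∞ φ ∧ h1Norm g (u - φ) < ε}

/-- The closure of a set `S` of functions in `H¹(M)`, for the `H¹` norm. -/
def closureH1 (g : Metric n M) (S : Set (M → ℝ)) : Set (M → ℝ) :=
  {u | u ∈ H1 g ∧ ∀ ε : ℝ≥0∞, 0 < ε → ∃ s ∈ S, h1Norm g (u - s) < ε}

/-- The functions of `H¹(M)` that vanish (almost everywhere) on an open neighborhood of `A`. -/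
def vanishingNear (g : Metric n M) (A : Set M) : Set (M → ℝ) :=
  {u | u ∈ H1 g ∧ ∃ U : Set M, IsOpen U ∧ A ⊆ U ∧ ∀ᵐ x ∂(vol g), x ∈ U → u x = 0}

/-- The space `H¹₀(M - A)` for an arbitrary subset `A`: the closure in `H¹(M)` of the functions
vanishing on an open neighborhood of `A`. -/
def H10 (g : Metric n M) (A : Set M) : Set (M → ℝ) :=
  closureH1 g (vanishingNear g A)

variable (n) in
/-- `C_c^∞(M - A)`: smooth functions with compact support contained in `M - A`, as functions on `M`
(extended by zero). -/
def testFunctions (A : Set M) : Set (M → ℝ) :=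
  {φ | ContMDiff (𝓡 n) 𝓘(ℝ, ℝ) ∞ φ ∧ HasCompactSupport φ ∧ tsupport φ ⊆ Aᶜ}

/-- The usual space `H¹₀(M - A)`: the closure of `C_c^∞(M - A)` for the `H¹` norm. -/
def usualH10 (g : Metric n M) (A : Set M) : Set (M → ℝ) :=
  closureH1 g (testFunctions n A)

end

end SobolevHoles

/-!
The inclusion `usualH10 g A ⊆ H10 g A` holds because a smooth function supported in `Aᶜ` vanishes on
the open neighborhood `(tsupport φ)ᶜ` of `A`, and because smooth functions on a compact manifold
belong to `H¹(M)` (`mem_H1_of_contMDiff`).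

For the converse it is enough to approximate a function `s ∈ H¹(M)` that vanishes almost everywhere
on an open set `U ⊇ A`. Choose a smooth `η` that is `0` near `A` and `1` outside `U`; then `s = η s`
almost everywhere. If `φ` is smooth and close to `s`, then `η φ` is a test function on `M - A`, and
`s - η φ = η (s - φ)` almost everywhere is small, since multiplication by `η` is bounded for the
`H¹` norm (`exists_h1Norm_smooth_mul_le`).

The boundedness of multiplication by `η` rests on the product rule for weak differentials
(`IsWeakDifferential.smooth_mul`) and on a uniform bound for `|dη|_g`
(`exists_coNorm_differential_le`). The formula `|α|_g² = ∑ gⁱʲ αᵢ αⱼ` in a chart (`coNorm_eq_sqrt`)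
gives this bound, and it also shows that `|du|_g` is measurable up to null sets
(`IsWeakDifferential.aemeasurable_coNorm`), as the triangle inequality for lower integrals requires.
To replace a function by one that is equal to it almost everywhere for the Riemannian volume, without
changing its weak differential, one needs to know that null sets for the volume are null sets for the
Lebesgue measure in all charts of the atlas, not only in those used to define the volume
(`ae_chart_of_ae_vol`).
-/

namespace SobolevHoles

/-! ### Coordinate vectors and the Gram matrix -/

section Charts

/-- The differential of a function on `M`, as a field of covectors. -/
noncomputable def differential {n : ℕ} {M : Type*} [TopologicalSpace M]
    [ChartedSpace (EuclideanSpace ℝ (Fin n)) M] (φ : M → ℝ) (x : M) :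
    TangentSpace (𝓡 n) x →L[ℝ] ℝ :=
  mfderiv (𝓡 n) 𝓘(ℝ, ℝ) φ x

variable {n : ℕ} {M : Type*} [TopologicalSpace M] [ChartedSpace (EuclideanSpace ℝ (Fin n)) M]
  [IsManifold (𝓡 n) ∞ M] {e : OpenPartialHomeomorph M (EuclideanSpace ℝ (Fin n))}

theorem contMDiffOn_symm_of_mem_atlas (he : e ∈ atlas (EuclideanSpace ℝ (Fin n)) M) :
    ContMDiffOn (𝓡 n) (𝓡 n) ∞ e.symm e.target :=
  contMDiffOn_symm_of_mem_maximalAtlas (IsManifold.subset_maximalAtlas he)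

theorem contMDiffAt_symm_of_mem_atlas (he : e ∈ atlas (EuclideanSpace ℝ (Fin n)) M)
    {y : EuclideanSpace ℝ (Fin n)} (hy : y ∈ e.target) :
    ContMDiffAt (𝓡 n) (𝓡 n) ∞ e.symm y :=
  (contMDiffOn_symm_of_mem_atlas he).contMDiffAt (e.open_target.mem_nhds hy)

theorem contDiffOn_comp_symm (he : e ∈ atlas (EuclideanSpace ℝ (Fin n)) M) {φ : M → ℝ}
    (hφ : ContMDiff (𝓡 n) 𝓘(ℝ, ℝ) ∞ φ) :
    ContDiffOn ℝ ∞ (fun y => φ (e.symm y)) e.target :=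
  contMDiffOn_iff_contDiffOn.1
    (hφ.comp_contMDiffOn (contMDiffOn_symm_of_mem_atlas he))

theorem differential_apply_coordVec (he : e ∈ atlas (EuclideanSpace ℝ (Fin n)) M) {φ : M → ℝ}
    (hφ : ContMDiff (𝓡 n) 𝓘(ℝ, ℝ) ∞ φ) {y : EuclideanSpace ℝ (Fin n)} (hy : y ∈ e.target)
    (i : Fin n) :
    differential φ (e.symm y) (coordVec e y i) =
      fderiv ℝ (fun y => φ (e.symm y)) y (EuclideanSpace.single i (1 : ℝ)) := by
  have h := mfderiv_comp (I := 𝓡 n) (I' := 𝓡 n) (I'' := 𝓘(ℝ, ℝ)) (f := e.symm) (g := φ) y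
    ((hφ _).mdifferentiableAt (by simp))
    ((contMDiffAt_symm_of_mem_atlas he hy).mdifferentiableAt (by simp))
  rw [← mfderiv_eq_fderiv]
  exact (congrArg (fun L => L (EuclideanSpace.single i (1 : ℝ))) h).symm

/-- The coordinate vector fields of a chart are continuous, as maps into the tangent bundle. -/
theorem contMDiffOn_coordVec (he : e ∈ atlas (EuclideanSpace ℝ (Fin n)) M) (i : Fin n) :
    ContMDiffOn (𝓡 n) (𝓡 n).tangent 0
      (fun y => (Bundle.TotalSpace.mk' (EuclideanSpace ℝ (Fin n)) (e.symm y) (coordVec e y i) :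
        TangentBundle (𝓡 n) M)) e.target := by
  have h1 := (contMDiffOn_symm_of_mem_atlas he).contMDiffOn_tangentMapWithin (m := 0) (by simp)
    e.open_target.uniqueMDiffOn
  have h2 : ContMDiff (𝓡 n) (𝓡 n).tangent 0 (fun y : EuclideanSpace ℝ (Fin n) =>
      (Bundle.TotalSpace.mk' (EuclideanSpace ℝ (Fin n)) y (EuclideanSpace.single i (1 : ℝ)) :
        TangentBundle (𝓡 n) (EuclideanSpace ℝ (Fin n)))) :=
    contMDiff_vectorSpace_iff_contDiff.2 contDiff_const
  refine (h1.comp h2.contMDiffOn (fun y hy => hy)).congr fun y hy => ?_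
  simp only [tangentMapWithin, Function.comp, coordVec]
  rw [mfderivWithin_of_isOpen e.open_target hy]

theorem continuousOn_gram (g : Metric n M) (he : e ∈ atlas (EuclideanSpace ℝ (Fin n)) M) :
    ContinuousOn (gram g e) e.target := by
  refine continuousOn_pi.2 fun i => continuousOn_pi.2 fun j => ?_
  have hs : ContMDiffOn (𝓡 n) (𝓡 n) 0 e.symm e.target :=
    (contMDiffOn_symm_of_mem_atlas he).of_le (by simp)
  have h := ContMDiffOn.clm_bundle_apply₂ (F₁ := EuclideanSpace ℝ (Fin n))
    (F₂ := EuclideanSpace ℝ (Fin n)) (F₃ := ℝ) (E₃ := Bundle.Trivial M ℝ)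
    ((g.contMDiff.of_le (by simp : (0 : WithTop ℕ∞) ≤ ((⊤ : ℕ∞) : WithTop ℕ∞))).comp_contMDiffOn hs)
    (contMDiffOn_coordVec he i) (contMDiffOn_coordVec he j)
  have h' : ContMDiffOn (𝓡 n) 𝓘(ℝ, ℝ) 0 (fun y => gram g e y i j) e.target := by
    intro y hy
    have := h y hy
    simp only [Bundle.contMDiffWithinAt_totalSpace] at this
    exact this.2
  exact h'.continuousOn

/-- The differential of `e.symm` at a point of the image of the chart `e`, as an isomorphism. -/
noncomputable def chartDerivEquiv (he : e ∈ atlas (EuclideanSpace ℝ (Fin n)) M)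
    {y : EuclideanSpace ℝ (Fin n)} (hy : y ∈ e.target) :
    EuclideanSpace ℝ (Fin n) ≃L[ℝ] TangentSpace (𝓡 n) (e.symm y) :=
  haveI : IsManifold (𝓡 n) 1 M := IsManifold.of_le (n := ∞) (by simp)
  OpenPartialHomeomorph.MDifferentiable.mfderiv
    (mdifferentiable_of_mem_atlas (I := 𝓡 n) he).symm hy

theorem sum_coordVec (he : e ∈ atlas (EuclideanSpace ℝ (Fin n)) M)
    {y : EuclideanSpace ℝ (Fin n)} (hy : y ∈ e.target) (c : Fin n → ℝ) :
    ∑ i, c i • coordVec e y i = chartDerivEquiv he hy (WithLp.toLp 2 c) := by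
  have h : (WithLp.toLp 2 c : EuclideanSpace ℝ (Fin n)) =
      ∑ i, c i • EuclideanSpace.single i (1 : ℝ) := by
    ext j
    simp [Finset.sum_apply, Pi.single_apply]
  rw [h, map_sum]
  refine Finset.sum_congr rfl fun i _ => ?_
  rw [map_smul]
  rfl

theorem exists_eq_sum_coordVec (he : e ∈ atlas (EuclideanSpace ℝ (Fin n)) M)
    {y : EuclideanSpace ℝ (Fin n)} (hy : y ∈ e.target) (v : TangentSpace (𝓡 n) (e.symm y)) :
    ∃ c : Fin n → ℝ, v = ∑ i, c i • coordVec e y i :=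
  ⟨WithLp.ofLp ((chartDerivEquiv he hy).symm v), by simp [sum_coordVec he hy]⟩

theorem sum_coordVec_ne_zero (he : e ∈ atlas (EuclideanSpace ℝ (Fin n)) M)
    {y : EuclideanSpace ℝ (Fin n)} (hy : y ∈ e.target) {c : Fin n → ℝ} (hc : c ≠ 0) :
    ∑ i, c i • coordVec e y i ≠ 0 := by
  rw [sum_coordVec he hy]
  simpa using hc

theorem inner_sum_coordVec (g : Metric n M) (y : EuclideanSpace ℝ (Fin n)) (c d : Fin n → ℝ) :
    g.inner (e.symm y) (∑ i, c i • coordVec e y i) (∑ i, d i • coordVec e y i) =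
      c ⬝ᵥ (gram g e y).mulVec d := by
  simp only [map_sum, map_smul, sum_apply, smul_apply, dotProduct, Matrix.mulVec,
    gram, Matrix.of_apply, smul_eq_mul, Finset.mul_sum]
  rw [Finset.sum_comm]
  refine Finset.sum_congr rfl fun i _ => Finset.sum_congr rfl fun j _ => by ring

theorem posDef_gram (g : Metric n M) (he : e ∈ atlas (EuclideanSpace ℝ (Fin n)) M)
    {y : EuclideanSpace ℝ (Fin n)} (hy : y ∈ e.target) : (gram g e y).PosDef := by
  refine Matrix.PosDef.of_dotProduct_mulVec_pos ?_ fun c hc => ?_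
  · ext i j
    simpa [gram] using g.symm _ _ _
  · rw [star_trivial, ← inner_sum_coordVec]
    exact g.pos _ _ (sum_coordVec_ne_zero he hy hc)

/-- The pointwise norm of a covector in coordinates: `|α|_g² = ∑ᵢⱼ gⁱʲ αᵢ αⱼ`. The supremum is
attained in the direction of the vector dual to `α`. -/
theorem coNorm_eq_sqrt (g : Metric n M) (he : e ∈ atlas (EuclideanSpace ℝ (Fin n)) M)
    {y : EuclideanSpace ℝ (Fin n)} (hy : y ∈ e.target)
    (α : TangentSpace (𝓡 n) (e.symm y) →L[ℝ] ℝ) :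
    coNorm g (e.symm y) α = ENNReal.ofReal (Real.sqrt
      ((fun i => α (coordVec e y i)) ⬝ᵥ
        ((gram g e y)⁻¹).mulVec (fun i => α (coordVec e y i)))) := by
  set a : Fin n → ℝ := fun i => α (coordVec e y i) with ha
  set b : Fin n → ℝ := ((gram g e y)⁻¹).mulVec a with hb
  have hdet : IsUnit (gram g e y).det := (posDef_gram g he hy).det_pos.ne'.isUnit
  have hGb : (gram g e y).mulVec b = a := by
    rw [hb, Matrix.mulVec_mulVec, Matrix.mul_nonsing_inv _ hdet, Matrix.one_mulVec]
  -- `w` is the vector dual to `α`: `α v = g(v, w)`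
  set w : TangentSpace (𝓡 n) (e.symm y) := ∑ i, b i • coordVec e y i with hw
  have hα : ∀ v, α v = g.inner (e.symm y) v w := by
    intro v
    obtain ⟨c, rfl⟩ := exists_eq_sum_coordVec he hy v
    rw [hw, inner_sum_coordVec, hGb]
    simp [dotProduct, ha]
  have hq : a ⬝ᵥ b = g.inner (e.symm y) w w := by
    rw [← hα w, hw]
    simp [dotProduct, ha, mul_comm]
  have hnn : ∀ v, 0 ≤ g.inner (e.symm y) v v := by
    intro v
    rcases eq_or_ne v 0 with rfl | hv
    · simp
    · exact (g.pos _ v hv).le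
  rw [hq]
  set q := g.inner (e.symm y) w w with hqdef
  have hq0 : 0 ≤ q := hnn w
  refine le_antisymm (iSup₂_le fun v hv => ?_) ?_
  · rw [← ofReal_norm, Real.norm_eq_abs]
    refine ENNReal.ofReal_le_ofReal (Real.abs_le_sqrt ?_)
    -- Cauchy–Schwarz: expand `0 ≤ |q • v - (α v) • w|²`
    rcases hq0.eq_or_lt with h0 | h0
    · have : w = 0 := by
        by_contra hne
        exact (g.pos _ w hne).ne' h0.symm
      rw [hα v, this]; simp [hq0]
    · have key := hnn (q • v - (α v) • w)
      simp only [map_sub, map_smul, sub_apply, smul_apply,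
        smul_eq_mul, g.symm _ w v, ← hα v, ← hqdef] at key
      have h1 : 0 ≤ q * (q * g.inner (e.symm y) v v - α v ^ 2) := by nlinarith
      have h2 := nonneg_of_mul_nonneg_right h1 h0
      nlinarith
  · rcases hq0.eq_or_lt with h0 | h0
    · simp [← h0]
    · have hs := Real.sqrt_pos.2 h0
      have hss := Real.mul_self_sqrt hq0
      refine le_trans (le_of_eq ?_) (le_iSup₂_of_le ((Real.sqrt q)⁻¹ • w) ?_ le_rfl)
      · rw [map_smul, hα w, ← hqdef, ← ofReal_norm, smul_eq_mul, Real.norm_eq_abs]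
        congr 1
        rw [abs_of_nonneg (by positivity)]
        field_simp
        nlinarith
      · simp only [map_smul, smul_apply, smul_eq_mul, ← hqdef]
        have : (Real.sqrt q)⁻¹ * ((Real.sqrt q)⁻¹ * q) = 1 := by
          field_simp
          nlinarith
        exact this.le

end Charts

/-! ### The Riemannian volume in charts -/

theorem aemeasurable_symm {n : ℕ} {M : Type*} [TopologicalSpace M] [MeasurableSpace M]
    [BorelSpace M] (f : EuclideanSpace ℝ (Fin n) → ℝ≥0∞)
    (e : OpenPartialHomeomorph M (EuclideanSpace ℝ (Fin n))) :
    AEMeasurable e.symm ((volume.restrict e.target).withDensity f) :=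
  (e.continuousOn_symm.aemeasurable e.open_target.measurableSet).mono_ac
    (withDensity_absolutelyContinuous _ _)

section Volume

variable {n : ℕ} {M : Type*} [TopologicalSpace M] [ChartedSpace (EuclideanSpace ℝ (Fin n)) M]
  [IsManifold (𝓡 n) ∞ M] {e : OpenPartialHomeomorph M (EuclideanSpace ℝ (Fin n))}

theorem continuousOn_sqrt_det_gram (g : Metric n M)
    (he : e ∈ atlas (EuclideanSpace ℝ (Fin n)) M) :
    ContinuousOn (fun y => Real.sqrt (gram g e y).det) e.target :=
  Real.continuous_sqrt.comp_continuousOn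
    (continuous_id.matrix_det.comp_continuousOn (continuousOn_gram g he))

theorem continuousOn_inv_gram (g : Metric n M)
    (he : e ∈ atlas (EuclideanSpace ℝ (Fin n)) M) :
    ContinuousOn (fun y => (gram g e y)⁻¹) e.target := by
  have h1 : ContinuousOn (fun y => (gram g e y).det) e.target :=
    continuous_id.matrix_det.comp_continuousOn (continuousOn_gram g he)
  have h2 : ContinuousOn (fun y => (gram g e y).adjugate) e.target :=
    continuous_id.matrix_adjugate.comp_continuousOn (continuousOn_gram g he)
  simp only [Matrix.inv_def, Ring.inverse_eq_inv']
  exact (h1.inv₀ fun y hy => (posDef_gram g he hy).det_pos.ne').smul h2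

theorem aemeasurable_gramDensity (g : Metric n M)
    (he : e ∈ atlas (EuclideanSpace ℝ (Fin n)) M) :
    AEMeasurable (fun y => ENNReal.ofReal (Real.sqrt (gram g e y).det))
      (volume.restrict e.target) :=
  ((continuousOn_sqrt_det_gram g he).aemeasurable e.open_target.measurableSet).ennreal_ofReal

section

variable [T2Space M] [CompactSpace M]

theorem finite_chartPartition :
    {p : M | (Function.support (chartPartition n M p)).Nonempty}.Finite :=
  (chartPartition n M).locallyFinite.finite_nonempty_of_compact

theorem exists_chartPartition_ne_zero (x : M) :
    ∃ p ∈ {p : M | (Function.support (chartPartition n M p)).Nonempty},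
      ENNReal.ofReal (chartPartition n M p x) ≠ 0 := by
  obtain ⟨p, hp⟩ := (chartPartition n M).exists_pos_of_mem (mem_univ x)
  exact ⟨p, ⟨x, hp.ne'⟩, by simpa using hp⟩

/-- Only finitely many charts contribute to the Riemannian volume. -/
theorem vol_eq_sum [MeasurableSpace M] (g : Metric n M) :
    vol g = ∑ p ∈ (finite_chartPartition (n := n) (M := M)).toFinset,
      (chartVolume g (chartAt (EuclideanSpace ℝ (Fin n)) p)).withDensity
        (fun x => ENNReal.ofReal (chartPartition n M p x)) := by
  ext s hs
  rw [vol, Measure.sum_apply _ hs, Measure.finsetSum_apply, tsum_eq_sum]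
  intro p hp
  have : (fun x => ENNReal.ofReal (chartPartition n M p x)) = 0 := by
    ext x
    by_contra hx
    exact hp ((Set.Finite.mem_toFinset _).2 ⟨x, fun h => hx (by simp [h])⟩)
  simp [this]

end

variable [MeasurableSpace M] [BorelSpace M]

/-- A property that holds almost everywhere in the coordinates of a chart holds almost everywhere
for the Riemannian volume of the chart. -/
theorem ae_chartVolume_of_ae (g : Metric n M)
    {P : M → Prop} (h : ∀ᵐ y ∂volume.restrict e.target, P (e.symm y)) :
    ∀ᵐ x ∂chartVolume g e, P x := by
  rw [ae_restrict_iff' e.open_target.measurableSet, ae_iff] at h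
  obtain ⟨T, hT, hTm, hT0⟩ := exists_measurable_superset_of_null h
  have hmeas : MeasurableSet (e.source ∩ e ⁻¹' Tᶜ) := by
    classical
    have hm : Measurable (e.source.piecewise e (fun _ => 0)) :=
      e.continuousOn.measurable_piecewise continuousOn_const e.open_source.measurableSet
    have heq : e.source ∩ e ⁻¹' Tᶜ = e.source ∩ e.source.piecewise e (fun _ => 0) ⁻¹' Tᶜ := by
      ext x
      simp +contextual [Set.piecewise]
    rw [heq]
    exact e.open_source.measurableSet.inter (hm hTm.compl)
  have hnull : chartVolume g e (e.source ∩ e ⁻¹' Tᶜ)ᶜ = 0 := by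
    rw [chartVolume, Measure.map_apply_of_aemeasurable (aemeasurable_symm _ e) hmeas.compl]
    refine withDensity_absolutelyContinuous _ _ ?_
    rw [Measure.restrict_apply' e.open_target.measurableSet]
    refine measure_mono_null (fun y hy => ?_) hT0
    by_contra hyT
    exact hy.1 ⟨e.map_target hy.2, by simpa [e.right_inv hy.2] using hyT⟩
  rw [ae_iff]
  refine measure_mono_null (t := (e.source ∩ e ⁻¹' Tᶜ)ᶜ) (fun x hx hxs => hx ?_) hnull
  by_contra hP
  exact hxs.2 (hT fun h => hP (by simpa [e.left_inv hxs.1] using h (e.map_source hxs.1)))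

/-- A property that holds almost everywhere for the part `ρ dV` of the Riemannian volume of a chart
holds almost everywhere in coordinates where `ρ ≠ 0`, because the density `√det g` is positive. -/
theorem ae_of_ae_withDensity_chartVolume (g : Metric n M)
    (he : e ∈ atlas (EuclideanSpace ℝ (Fin n)) M) {ρ : M → ℝ≥0∞} (hρ : Measurable ρ)
    {P : M → Prop} (h : ∀ᵐ x ∂(chartVolume g e).withDensity ρ, P x) :
    ∀ᵐ y ∂volume.restrict e.target, ρ (e.symm y) ≠ 0 → P (e.symm y) := by
  rw [ae_withDensity_iff hρ] at h
  have h2 := ae_of_ae_map (aemeasurable_symm _ e) h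
  rw [ae_withDensity_iff' (aemeasurable_gramDensity g he)] at h2
  filter_upwards [h2, ae_restrict_mem e.open_target.measurableSet] with y hy hyt
  exact hy (by simpa using Real.sqrt_pos.2 (posDef_gram g he hyt).det_pos)

/-- Compact subsets of the domain of a chart have finite Riemannian volume. -/
theorem chartVolume_lt_top (g : Metric n M)
    (he : e ∈ atlas (EuclideanSpace ℝ (Fin n)) M) {K : Set M} (hK : IsCompact K)
    (hKm : MeasurableSet K) (hKe : K ⊆ e.source) : chartVolume g e K < ⊤ := by
  have hset : e.symm ⁻¹' K ∩ e.target = e '' K := by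
    ext y
    constructor
    · rintro ⟨h1, h2⟩
      exact ⟨_, h1, e.right_inv h2⟩
    · rintro ⟨x, hx, rfl⟩
      exact ⟨by simpa [e.left_inv (hKe hx)] using hx, e.map_source (hKe hx)⟩
  rw [chartVolume, Measure.map_apply_of_aemeasurable (aemeasurable_symm _ e) hKm,
    withDensity_apply' _ _, Measure.restrict_restrict' e.open_target.measurableSet, hset]
  have hc : IsCompact (e '' K) := hK.image_of_continuousOn (e.continuousOn.mono hKe)
  refine Integrable.lintegral_lt_top ?_
  refine ContinuousOn.integrableOn_compact hc ((continuousOn_sqrt_det_gram g he).mono ?_)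
  rintro _ ⟨x, hx, rfl⟩
  exact e.map_source (hKe hx)

variable [T2Space M] [CompactSpace M]

theorem measurable_chartPartition (p : M) :
    Measurable (fun x => ENNReal.ofReal (chartPartition n M p x)) :=
  (chartPartition n M p).contMDiff.continuous.measurable.ennreal_ofReal

theorem isFiniteMeasure_vol (g : Metric n M) : IsFiniteMeasure (vol g) := by
  refine ⟨?_⟩
  rw [vol_eq_sum, Measure.finsetSum_apply]
  refine ENNReal.sum_lt_top.2 fun p _ => ?_
  rw [withDensity_apply _ MeasurableSet.univ, Measure.restrict_univ]
  have hcl : IsClosed (tsupport (chartPartition n M p)) := isClosed_tsupport _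
  refine lt_of_le_of_lt ?_ (chartVolume_lt_top g (chart_mem_atlas _ p) hcl.isCompact
    hcl.measurableSet (chartPartition_isSubordinate n M p))
  rw [← lintegral_indicator_one hcl.measurableSet]
  refine lintegral_mono fun x => ?_
  by_cases hx : x ∈ tsupport (chartPartition n M p)
  · simpa [hx] using (chartPartition n M).le_one p x
  · simp [hx, image_eq_zero_of_notMem_tsupport hx]

/-- A property that holds almost everywhere for the Riemannian volume holds almost everywhere in
the coordinates of any chart of the atlas: transition maps are differentiable, so they preserve
null sets. -/
theorem ae_chart_of_ae_vol (g : Metric n M) (he : e ∈ atlas (EuclideanSpace ℝ (Fin n)) M)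
    {P : M → Prop} (h : ∀ᵐ x ∂vol g, P x) :
    ∀ᵐ y ∂volume.restrict e.target, P (e.symm y) := by
  rw [ae_restrict_iff' e.open_target.measurableSet, ae_iff]
  let T : M → Set (EuclideanSpace ℝ (Fin n)) := fun p =>
    {z | z ∈ (chartAt (EuclideanSpace ℝ (Fin n)) p).target ∧
      (chartAt (EuclideanSpace ℝ (Fin n)) p).symm z ∈ e.source ∧
      ENNReal.ofReal (chartPartition n M p
        ((chartAt (EuclideanSpace ℝ (Fin n)) p).symm z)) ≠ 0 ∧
      ¬ P ((chartAt (EuclideanSpace ℝ (Fin n)) p).symm z)}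
  have hT : ∀ p, volume (T p) = 0 := by
    intro p
    have h1 := ae_of_ae_withDensity_chartVolume g (chart_mem_atlas _ p)
      (measurable_chartPartition p) ((Measure.le_sum _ p).absolutelyContinuous.ae_le h)
    rw [ae_restrict_iff' (OpenPartialHomeomorph.open_target _).measurableSet, ae_iff] at h1
    refine measure_mono_null (fun z hz => ?_) h1
    simp only [mem_ofPred_eq, Classical.not_imp]
    exact ⟨hz.1, hz.2.2.1, hz.2.2.2⟩
  have himg : ∀ p, volume ((fun z => e ((chartAt (EuclideanSpace ℝ (Fin n)) p).symm z)) '' T p)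
      = 0 := by
    intro p
    refine addHaar_image_eq_zero_of_differentiableOn_of_addHaar_eq_zero _ (fun z hz => ?_) (hT p)
    have h1 := contMDiffAt_symm_of_mem_atlas (chart_mem_atlas (EuclideanSpace ℝ (Fin n)) p) hz.1
    have h2 := contMDiffAt_of_mem_maximalAtlas (I := 𝓡 n) (n := ∞)
      (IsManifold.subset_maximalAtlas he) hz.2.1
    have h3 := contMDiffAt_iff_contDiffAt.1 (h2.comp z h1)
    exact (h3.differentiableAt (by simp)).differentiableWithinAt
  refine measure_mono_null (fun y hy => ?_) ((measure_biUnion_null_iff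
    (finite_chartPartition (n := n) (M := M)).countable).2 fun p _ => himg p)
  simp only [mem_ofPred_eq, Classical.not_imp] at hy
  obtain ⟨p, hp, hpx⟩ := exists_chartPartition_ne_zero (n := n) (e.symm y)
  have hs : e.symm y ∈ (chartAt (EuclideanSpace ℝ (Fin n)) p).source :=
    chartPartition_isSubordinate n M p (subset_tsupport _ fun h0 => hpx (by simp [h0]))
  have hl := (chartAt (EuclideanSpace ℝ (Fin n)) p).left_inv hs
  refine mem_biUnion hp ⟨chartAt (EuclideanSpace ℝ (Fin n)) p (e.symm y), ⟨?_, ?_, ?_, ?_⟩, ?_⟩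
  · exact OpenPartialHomeomorph.map_source _ hs
  · rw [hl]; exact e.map_target hy.1
  · rwa [hl]
  · rw [hl]; exact hy.2
  · simp only [hl, e.right_inv hy.1]

end Volume

/-! ### Weak differentials -/

theorem integrableOn_mul_of_tsupport_subset {E : Type*} [NormedAddCommGroup E]
    [MeasurableSpace E] [BorelSpace E] {μ : Measure E} {U : Set E} {f h : E → ℝ}
    (hf : LocallyIntegrableOn f U μ) (hh : Continuous h) (hc : HasCompactSupport h)
    (hU : tsupport h ⊆ U) : IntegrableOn (fun y => f y * h y) U μ := by
  have h1 : IntegrableOn (fun y => f y * h y) (tsupport h) μ :=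
    (hf.integrableOn_compact_subset hU hc.isCompact).mul_continuousOn hh.continuousOn hc.isCompact
  refine Integrable.integrableOn ?_
  refine (integrableOn_iff_integrable_of_support_subset fun y hy => subset_tsupport h ?_).1 h1
  exact fun h0 => hy (by simp [h0])

/-- The product of a test function supported in `U` and a function that is smooth on `U` only is
smooth everywhere. -/
theorem contDiff_mul_of_tsupport_subset {E : Type*} [NormedAddCommGroup E] [NormedSpace ℝ E]
    {U : Set E} (hUo : IsOpen U) {f ψ : E → ℝ} (hf : ContDiffOn ℝ ∞ f U) (hψ : ContDiff ℝ ∞ ψ)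
    (hU : tsupport ψ ⊆ U) : ContDiff ℝ ∞ (fun y => f y * ψ y) := by
  refine contMDiff_iff_contDiff.1 (contMDiff_of_tsupport fun y hy => ?_)
  have hyU : y ∈ U := hU (tsupport_mul_subset_right hy)
  exact ((hf.contDiffAt (hUo.mem_nhds hyU)).mul hψ.contDiffAt).contMDiffAt

section Manifold

variable {n : ℕ} {M : Type*} [TopologicalSpace M] [ChartedSpace (EuclideanSpace ℝ (Fin n)) M]

namespace IsWeakDifferential

variable {u v : M → ℝ} {α β : (x : M) → TangentSpace (𝓡 n) x →L[ℝ] ℝ}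

theorem add (hu : IsWeakDifferential u α) (hv : IsWeakDifferential v β) :
    IsWeakDifferential (u + v) (fun x => α x + β x) := by
  intro e he
  obtain ⟨hu0, hu1⟩ := hu e he
  obtain ⟨hv0, hv1⟩ := hv e he
  refine ⟨hu0.add hv0, fun i => ⟨(hu1 i).1.add (hv1 i).1, fun ψ hψ hc hs => ?_⟩⟩
  have hd : Continuous (fun y => fderiv ℝ ψ y (EuclideanSpace.single i (1 : ℝ))) :=
    (hψ.continuous_fderiv (by simp)).clm_apply continuous_const
  have hdc := hc.fderiv_apply ℝ (EuclideanSpace.single i (1 : ℝ))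
  have hds := (tsupport_fderiv_apply_subset ℝ (EuclideanSpace.single i (1 : ℝ))).trans hs
  simp only [Pi.add_apply, add_apply, add_mul]
  rw [integral_add (integrableOn_mul_of_tsupport_subset hu0 hd hdc hds)
      (integrableOn_mul_of_tsupport_subset hv0 hd hdc hds),
    integral_add (integrableOn_mul_of_tsupport_subset (hu1 i).1 hψ.continuous hc hs)
      (integrableOn_mul_of_tsupport_subset (hv1 i).1 hψ.continuous hc hs),
    (hu1 i).2 ψ hψ hc hs, (hv1 i).2 ψ hψ hc hs, neg_add]

theorem congr (hu : IsWeakDifferential u α)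
    (h : ∀ e ∈ atlas (EuclideanSpace ℝ (Fin n)) M,
      ∀ᵐ y ∂volume.restrict e.target, u (e.symm y) = v (e.symm y)) :
    IsWeakDifferential v α := by
  intro e he
  obtain ⟨hu0, hu1⟩ := hu e he
  refine ⟨hu0.congr (h e he), fun i => ⟨(hu1 i).1, fun ψ hψ hc hs => ?_⟩⟩
  rw [← (hu1 i).2 ψ hψ hc hs]
  refine integral_congr_ae ?_
  filter_upwards [h e he] with y hy
  rw [hy]

/-- Constants have weak differential zero: a test function and its derivatives vanish at
infinity, so the derivatives have integral zero. -/
theorem one : IsWeakDifferential (1 : M → ℝ) (fun x => (0 : TangentSpace (𝓡 n) x →L[ℝ] ℝ)) := by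
  intro e he
  refine ⟨(locallyIntegrable_const 1).locallyIntegrableOn _,
    fun i => ⟨locallyIntegrable_zero.locallyIntegrableOn _, fun ψ hψ hc hs => ?_⟩⟩
  have hd : Continuous (fun y => fderiv ℝ ψ y (EuclideanSpace.single i (1 : ℝ))) :=
    (hψ.continuous_fderiv (by simp)).clm_apply continuous_const
  have hdc := hc.fderiv_apply ℝ (EuclideanSpace.single i (1 : ℝ))
  have hds := (tsupport_fderiv_apply_subset ℝ (EuclideanSpace.single i (1 : ℝ))).trans hs
  rw [setIntegral_eq_integral_of_forall_compl_eq_zero]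
  · have h := integral_mul_fderiv_eq_neg_fderiv_mul_of_integrable (μ := volume)
      (f := fun _ : EuclideanSpace ℝ (Fin n) => (1 : ℝ)) (g := ψ)
      (v := EuclideanSpace.single i (1 : ℝ)) (by simp)
      (by simpa using hd.integrable_of_hasCompactSupport hdc)
      (by simpa using hψ.continuous.integrable_of_hasCompactSupport hc)
      (fun _ _ => differentiableAt_const _)
      (fun y _ => hψ.contDiffAt.differentiableAt (by simp))
    simpa using h
  · intro y hy
    simp [image_eq_zero_of_notMem_tsupport (fun h => hy (hds h))]

variable [IsManifold (𝓡 n) ∞ M]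

/-- The product rule for a smooth function and a function with a weak differential. -/
theorem smooth_mul (hu : IsWeakDifferential u α) {η : M → ℝ}
    (hη : ContMDiff (𝓡 n) 𝓘(ℝ, ℝ) ∞ η) :
    IsWeakDifferential (η * u) (fun x => η x • α x + u x • differential η x) := by
  intro e he
  obtain ⟨hu0, hu1⟩ := hu e he
  have hUo := e.open_target
  have hf := contDiffOn_comp_symm he hη
  set f : EuclideanSpace ℝ (Fin n) → ℝ := fun y => η (e.symm y) with hfdef
  have hdf : ∀ i : Fin n, ContinuousOn
      (fun y => fderiv ℝ f y (EuclideanSpace.single i (1 : ℝ))) e.target := fun i =>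
    (hf.continuousOn_fderiv_of_isOpen hUo (by simp)).clm_apply continuousOn_const
  have hcoord : ∀ i, ∀ y ∈ e.target,
      (η (e.symm y) • α (e.symm y) + u (e.symm y) • differential η (e.symm y) :
        TangentSpace (𝓡 n) (e.symm y) →L[ℝ] ℝ) (coordVec e y i) =
      f y * α (e.symm y) (coordVec e y i) +
        u (e.symm y) * fderiv ℝ f y (EuclideanSpace.single i (1 : ℝ)) := by
    intro i y hy
    have := differential_apply_coordVec he hη hy i
    simp only [add_apply, smul_apply, smul_eq_mul]
    rw [this]
  have hud : ∀ i : Fin n, LocallyIntegrableOn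
      (fun y => u (e.symm y) * fderiv ℝ f y (EuclideanSpace.single i (1 : ℝ))) e.target :=
    fun i => hu0.mul_continuousOn (hdf i) hUo.isLocallyClosed
  refine ⟨hu0.continuousOn_mul hf.continuousOn hUo.isLocallyClosed,
    fun i => ⟨?_, fun ψ hψ hc hs => ?_⟩⟩
  · refine (((hu1 i).1.continuousOn_mul hf.continuousOn hUo.isLocallyClosed).add (hud i)).congr ?_
    filter_upwards [ae_restrict_mem hUo.measurableSet] with y hy
    exact (hcoord i y hy).symm
  · have hfψ := contDiff_mul_of_tsupport_subset hUo hf hψ hs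
    have hfψc : HasCompactSupport (fun y => f y * ψ y) := hc.mul_left
    have hfψs : tsupport (fun y => f y * ψ y) ⊆ e.target :=
      tsupport_mul_subset_right.trans hs
    have hd : Continuous (fun y => fderiv ℝ (fun y => f y * ψ y) y
        (EuclideanSpace.single i (1 : ℝ))) :=
      (hfψ.continuous_fderiv (by simp)).clm_apply continuous_const
    have hdc := hfψc.fderiv_apply ℝ (EuclideanSpace.single i (1 : ℝ))
    have hds := (tsupport_fderiv_apply_subset ℝ (f := fun y => f y * ψ y)
      (EuclideanSpace.single i (1 : ℝ))).trans hfψs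
    -- the weak derivative of `u` is tested against `f ψ`, where `f` is `η` in coordinates
    have hL : ∀ y ∈ e.target, (η * u) (e.symm y) * fderiv ℝ ψ y (EuclideanSpace.single i (1 : ℝ)) =
        u (e.symm y) * fderiv ℝ (fun y => f y * ψ y) y (EuclideanSpace.single i (1 : ℝ)) -
        (u (e.symm y) * fderiv ℝ f y (EuclideanSpace.single i (1 : ℝ))) * ψ y := by
      intro y hy
      rw [fderiv_fun_mul ((hf.contDiffAt (hUo.mem_nhds hy)).differentiableAt (by simp))
        (hψ.contDiffAt.differentiableAt (by simp))]
      simp only [add_apply, smul_apply, smul_eq_mul, Pi.mul_apply, hfdef]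
      ring
    have hR : ∀ y ∈ e.target,
        (η (e.symm y) • α (e.symm y) + u (e.symm y) • differential η (e.symm y) :
          TangentSpace (𝓡 n) (e.symm y) →L[ℝ] ℝ) (coordVec e y i) * ψ y =
        α (e.symm y) (coordVec e y i) * (f y * ψ y) +
        (u (e.symm y) * fderiv ℝ f y (EuclideanSpace.single i (1 : ℝ))) * ψ y := by
      intro y hy
      rw [hcoord i y hy]
      ring
    rw [setIntegral_congr_fun hUo.measurableSet hL, setIntegral_congr_fun hUo.measurableSet hR,
      integral_sub (integrableOn_mul_of_tsupport_subset hu0 hd hdc hds)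
        (integrableOn_mul_of_tsupport_subset (hud i) hψ.continuous hc hs),
      integral_add (integrableOn_mul_of_tsupport_subset (hu1 i).1 hfψ.continuous hfψc hfψs)
        (integrableOn_mul_of_tsupport_subset (hud i) hψ.continuous hc hs),
      (hu1 i).2 _ hfψ hfψc hfψs]
    ring

end IsWeakDifferential

variable [IsManifold (𝓡 n) ∞ M]

theorem isWeakDifferential_differential {φ : M → ℝ} (hφ : ContMDiff (𝓡 n) 𝓘(ℝ, ℝ) ∞ φ) :
    IsWeakDifferential φ (differential (n := n) φ) := by
  simpa using IsWeakDifferential.one.smooth_mul hφ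

/-! ### The pointwise norm of covectors -/

theorem coNorm_add_le (g : Metric n M) (x : M) (α β : TangentSpace (𝓡 n) x →L[ℝ] ℝ) :
    coNorm g x (α + β) ≤ coNorm g x α + coNorm g x β :=
  iSup₂_le fun v hv => (enorm_add_le _ _).trans
    (add_le_add (le_iSup₂_of_le v hv le_rfl) (le_iSup₂_of_le v hv le_rfl))

theorem coNorm_smul_le (g : Metric n M) (x : M) (c : ℝ) (α : TangentSpace (𝓡 n) x →L[ℝ] ℝ) :
    coNorm g x (c • α) ≤ ‖c‖ₑ * coNorm g x α :=
  iSup₂_le fun v hv => by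
    rw [smul_apply, enorm_smul]
    gcongr
    exact le_iSup₂_of_le v hv le_rfl

/-- On a compact manifold, the differential of a smooth function is bounded: in coordinates, its
pointwise norm is a continuous function. -/
theorem exists_coNorm_differential_le [CompactSpace M] (g : Metric n M) {φ : M → ℝ}
    (hφ : ContMDiff (𝓡 n) 𝓘(ℝ, ℝ) ∞ φ) :
    ∃ C : NNReal, ∀ x, coNorm g x (differential φ x) ≤ C := by
  suffices h : ∃ C : NNReal, ∀ x ∈ (univ : Set M), coNorm g x (differential φ x) ≤ C by simpa using h
  refine isCompact_univ.induction_on ⟨0, by simp⟩ ?_ ?_ ?_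
  · rintro s t hst ⟨C, hC⟩
    exact ⟨C, fun x hx => hC x (hst hx)⟩
  · rintro s t ⟨C, hC⟩ ⟨D, hD⟩
    refine ⟨max C D, fun x hx => hx.elim (fun h => (hC x h).trans ?_) fun h => (hD x h).trans ?_⟩
    · exact_mod_cast le_max_left C D
    · exact_mod_cast le_max_right C D
  · intro x₀ _
    set e := chartAt (EuclideanSpace ℝ (Fin n)) x₀ with hedef
    have he : e ∈ atlas (EuclideanSpace ℝ (Fin n)) M := chart_mem_atlas _ x₀
    have hx₀ : x₀ ∈ e.source := mem_chart_source _ x₀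
    let a : EuclideanSpace ℝ (Fin n) → Fin n → ℝ := fun y i =>
      fderiv ℝ (fun y => φ (e.symm y)) y (EuclideanSpace.single i (1 : ℝ))
    let F : EuclideanSpace ℝ (Fin n) → ℝ := fun y =>
      Real.sqrt (a y ⬝ᵥ ((gram g e y)⁻¹).mulVec (a y))
    have ha : ContinuousOn a e.target := continuousOn_pi.2 fun i =>
      ((contDiffOn_comp_symm he hφ).continuousOn_fderiv_of_isOpen e.open_target
        (by simp)).clm_apply continuousOn_const
    have hG := continuousOn_inv_gram g he
    have hF : ContinuousOn F e.target := by
      refine Real.continuous_sqrt.comp_continuousOn ?_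
      simp only [dotProduct, Matrix.mulVec]
      refine continuousOn_finsetSum _ fun i _ => (continuousOn_pi.1 ha i).mul ?_
      exact continuousOn_finsetSum _ fun j _ =>
        (continuousOn_pi.1 (continuousOn_pi.1 hG i) j).mul (continuousOn_pi.1 ha j)
    have hval : ∀ y ∈ e.target,
        coNorm g (e.symm y) (differential φ (e.symm y)) = ENNReal.ofReal (F y) := by
      intro y hy
      rw [coNorm_eq_sqrt g he hy]
      have : (fun i => differential φ (e.symm y) (coordVec e y i)) = a y :=
        funext fun i => differential_apply_coordVec he hφ hy i
      rw [this]
    have hcont : ContinuousAt (fun x => F (e x)) x₀ :=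
      ContinuousAt.comp (g := F) (hF.continuousAt (e.open_target.mem_nhds (e.map_source hx₀)))
        (e.continuousAt hx₀)
    have hev := hcont.eventually (gt_mem_nhds (lt_add_one (F (e x₀))))
    refine ⟨{x | x ∈ e.source ∧ F (e x) < F (e x₀) + 1}, mem_nhdsWithin_of_mem_nhds
      (Filter.inter_mem (e.open_source.mem_nhds hx₀) hev), (F (e x₀) + 1).toNNReal, ?_⟩
    rintro x ⟨hx, hlt⟩
    have h := hval (e x) (e.map_source hx)
    rw [e.left_inv hx] at h
    rw [h]
    exact ENNReal.ofReal_le_ofReal hlt.le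

variable [MeasurableSpace M] [BorelSpace M]

theorem aemeasurable_chartVolume (g : Metric n M)
    (e : OpenPartialHomeomorph M (EuclideanSpace ℝ (Fin n))) {f : M → ℝ≥0∞}
    (hf : AEMeasurable (fun y => f (e.symm y)) (volume.restrict e.target)) :
    AEMeasurable f (chartVolume g e) := by
  have hsource : ∀ᵐ x ∂chartVolume g e, x ∈ e.source := by
    refine ae_chartVolume_of_ae g ?_
    filter_upwards [ae_restrict_mem e.open_target.measurableSet] with y hy
    exact e.map_target hy
  have he : AEMeasurable e (chartVolume g e) := by
    rw [← Measure.restrict_eq_self_of_ae_mem hsource]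
    exact e.continuousOn.aemeasurable e.open_source.measurableSet
  refine (hf.measurable_mk.comp_aemeasurable he).congr ?_
  refine ae_chartVolume_of_ae g ?_
  filter_upwards [hf.ae_eq_mk, ae_restrict_mem e.open_target.measurableSet] with y hy hyt
  simp only [Function.comp, e.right_inv hyt, ← hy]

/-- The components of a weak differential are locally integrable, hence its pointwise norm is
measurable up to null sets. -/
theorem IsWeakDifferential.aemeasurable_coNorm [T2Space M] [CompactSpace M] (g : Metric n M)
    {u : M → ℝ} {α : (x : M) → TangentSpace (𝓡 n) x →L[ℝ] ℝ} (h : IsWeakDifferential u α) :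
    AEMeasurable (fun x => coNorm g x (α x)) (vol g) := by
  have hchart : ∀ e ∈ atlas (EuclideanSpace ℝ (Fin n)) M,
      AEMeasurable (fun x => coNorm g x (α x)) (chartVolume g e) := by
    intro e he
    have hm := e.open_target.measurableSet
    refine aemeasurable_chartVolume g e ?_
    have ha : ∀ i, AEMeasurable (fun y => α (e.symm y) (coordVec e y i))
        (volume.restrict e.target) := fun i =>
      ((h e he).2 i).1.aestronglyMeasurable.aemeasurable
    have hG : ∀ i j, AEMeasurable (fun y => (gram g e y)⁻¹ i j) (volume.restrict e.target) :=
      fun i j => (continuousOn_pi.1 (continuousOn_pi.1 (continuousOn_inv_gram g he) i)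
        j).aemeasurable hm
    have hF : AEMeasurable (fun y => ENNReal.ofReal (Real.sqrt
        ((fun i => α (e.symm y) (coordVec e y i)) ⬝ᵥ
        ((gram g e y)⁻¹).mulVec (fun i => α (e.symm y) (coordVec e y i)))))
        (volume.restrict e.target) := by
      refine AEMeasurable.ennreal_ofReal (Real.continuous_sqrt.measurable.comp_aemeasurable ?_)
      simp only [dotProduct, Matrix.mulVec]
      exact Finset.aemeasurable_fun_sum _ fun i _ => (ha i).mul
        (Finset.aemeasurable_fun_sum _ fun j _ => (hG i j).mul (ha j))
    refine hF.congr ?_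
    filter_upwards [ae_restrict_mem hm] with y hy
    exact (coNorm_eq_sqrt g he hy _).symm
  rw [vol_eq_sum, ← Measure.sum_coe_finset]
  exact AEMeasurable.sum_measure fun p =>
    (hchart _ (chart_mem_atlas _ _)).mono_ac (withDensity_absolutelyContinuous _ _)

end Manifold

/-! ### Estimates for the `H¹` norm -/

theorem ennreal_add_sq_le (a b : ℝ≥0∞) : (a + b) ^ 2 ≤ 2 * (a ^ 2 + b ^ 2) := by
  rcases eq_or_ne a ⊤ with rfl | ha
  · simp
  rcases eq_or_ne b ⊤ with rfl | hb
  · simp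
  lift a to NNReal using ha
  lift b to NNReal using hb
  have h : (a + b) ^ 2 ≤ 2 * (a ^ 2 + b ^ 2) := add_sq_le
  exact_mod_cast h

section H1Norm

variable {n : ℕ} {M : Type*} [TopologicalSpace M] [ChartedSpace (EuclideanSpace ℝ (Fin n)) M]
  [IsManifold (𝓡 n) ∞ M] [T2Space M] [CompactSpace M] [MeasurableSpace M]
  {g : Metric n M} {u v : M → ℝ} {α : (x : M) → TangentSpace (𝓡 n) x →L[ℝ] ℝ}

/-- The square of the `H¹` norm of `u`, computed with the weak differential `α`. -/
noncomputable def h1Energy (g : Metric n M) (u : M → ℝ)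
    (α : (x : M) → TangentSpace (𝓡 n) x →L[ℝ] ℝ) : ℝ≥0∞ :=
  ∫⁻ x, ‖u x‖ₑ ^ 2 ∂(vol g) + ∫⁻ x, coNorm g x (α x) ^ 2 ∂(vol g)

theorem h1Norm_le (h : IsWeakDifferential u α) {δ : ℝ≥0∞} (hE : h1Energy g u α ≤ δ ^ 2) :
    h1Norm g u ≤ δ := by
  refine (iInf₂_le α h).trans ?_
  refine (ENNReal.rpow_le_rpow hE (by norm_num)).trans (le_of_eq ?_)
  rw [← ENNReal.rpow_natCast, ← ENNReal.rpow_mul]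
  norm_num

theorem exists_h1Energy_le_of_h1Norm_lt {δ : ℝ≥0∞} (h : h1Norm g u < δ) :
    ∃ α, IsWeakDifferential u α ∧ h1Energy g u α ≤ δ ^ 2 := by
  simp only [h1Norm, iInf_lt_iff] at h
  obtain ⟨α, hα, hlt⟩ := h
  refine ⟨α, hα, ?_⟩
  have := pow_le_pow_left₀ (zero_le) hlt.le 2
  rwa [← ENNReal.rpow_natCast, ← ENNReal.rpow_mul, show (1 / 2 : ℝ) * ((2 : ℕ) : ℝ) = 1 by norm_num,
    ENNReal.rpow_one] at this

theorem closureH1_mono (g : Metric n M) {S T : Set (M → ℝ)} (h : S ⊆ T) :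
    closureH1 g S ⊆ closureH1 g T := fun _ hu =>
  ⟨hu.1, fun ε hε => (hu.2 ε hε).imp fun _ hs => ⟨h hs.1, hs.2⟩⟩

/-- Multiplication by a smooth function is bounded for the `H¹` norm: `d(ηu) = η du + u dη`, with
`η` and `dη` bounded. -/
theorem exists_h1Norm_smooth_mul_le (g : Metric n M) {η : M → ℝ}
    (hη : ContMDiff (𝓡 n) 𝓘(ℝ, ℝ) ∞ η) :
    ∃ K : NNReal, ∀ u : M → ℝ, AEMeasurable u (vol g) → ∀ δ : ℝ≥0∞, h1Norm g u < δ →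
      h1Norm g (η * u) ≤ K * δ := by
  obtain ⟨C₁, hC₁⟩ := exists_coNorm_differential_le g hη
  obtain ⟨C₂, hC₂⟩ := isCompact_univ.exists_bound_of_continuousOn hη.continuous.continuousOn
  obtain ⟨C, hd, hn⟩ : ∃ C : NNReal, (∀ x, coNorm g x (differential η x) ≤ C) ∧
      ∀ x, ‖η x‖ₑ ≤ C := by
    refine ⟨max C₁ C₂.toNNReal, fun x => (hC₁ x).trans (by exact_mod_cast le_max_left _ _),
      fun x => ?_⟩
    rw [← ofReal_norm]
    exact (ENNReal.ofReal_le_ofReal (hC₂ x (mem_univ x))).trans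
      (ENNReal.coe_le_coe.2 (le_max_right C₁ C₂.toNNReal))
  refine ⟨2 * C, fun u hu δ hδ => ?_⟩
  obtain ⟨α, hα, hE⟩ := exists_h1Energy_le_of_h1Norm_lt hδ
  refine h1Norm_le (hα.smooth_mul hη) ?_
  have hC : (C : ℝ≥0∞) ^ 2 ≠ ⊤ := by simp
  have e1 : ∫⁻ x, ‖(η * u) x‖ₑ ^ 2 ∂(vol g) ≤ C ^ 2 * ∫⁻ x, ‖u x‖ₑ ^ 2 ∂(vol g) := by
    rw [← lintegral_const_mul' _ _ hC]
    refine lintegral_mono fun x => ?_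
    rw [Pi.mul_apply, enorm_mul, mul_pow]
    gcongr
    exact hn x
  have e2 : ∫⁻ x, coNorm g x (η x • α x + u x • differential η x) ^ 2 ∂(vol g) ≤
      2 * C ^ 2 * (∫⁻ x, coNorm g x (α x) ^ 2 ∂(vol g) + ∫⁻ x, ‖u x‖ₑ ^ 2 ∂(vol g)) := by
    rw [← lintegral_add_right' _ (hu.enorm.pow_const 2),
      ← lintegral_const_mul' _ _ (ENNReal.mul_ne_top (by simp) hC)]
    refine lintegral_mono fun x => ?_
    have h : coNorm g x (η x • α x + u x • differential η x) ≤
        C * coNorm g x (α x) + ‖u x‖ₑ * C := by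
      refine (coNorm_add_le g x _ _).trans (add_le_add ?_ ?_)
      · refine (coNorm_smul_le g x _ _).trans ?_
        gcongr
        exact hn x
      · refine (coNorm_smul_le g x _ _).trans ?_
        gcongr
        exact hd x
    calc _ ≤ (C * coNorm g x (α x) + ‖u x‖ₑ * C) ^ 2 := by gcongr
      _ ≤ _ := ennreal_add_sq_le _ _
      _ = _ := by ring
  calc h1Energy g (η * u) (fun x => η x • α x + u x • differential η x)
      ≤ C ^ 2 * ∫⁻ x, ‖u x‖ₑ ^ 2 ∂(vol g) + 2 * C ^ 2 *
        (∫⁻ x, coNorm g x (α x) ^ 2 ∂(vol g) + ∫⁻ x, ‖u x‖ₑ ^ 2 ∂(vol g)) := add_le_add e1 e2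
    -- a further nonnegative term turns the bound into a multiple of the energy
    _ ≤ C ^ 2 * ∫⁻ x, ‖u x‖ₑ ^ 2 ∂(vol g) + 2 * C ^ 2 *
        (∫⁻ x, coNorm g x (α x) ^ 2 ∂(vol g) + ∫⁻ x, ‖u x‖ₑ ^ 2 ∂(vol g)) +
        (C ^ 2 * ∫⁻ x, ‖u x‖ₑ ^ 2 ∂(vol g) + 2 * C ^ 2 * ∫⁻ x, coNorm g x (α x) ^ 2 ∂(vol g)) :=
      le_self_add
    _ = (2 * C) ^ 2 * h1Energy g u α := by
      simp only [h1Energy]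
      ring
    _ ≤ (2 * C) ^ 2 * δ ^ 2 := by gcongr
    _ = (((2 * C : NNReal) : ℝ≥0∞) * δ) ^ 2 := by
      push_cast
      ring

theorem h1Norm_zero (g : Metric n M) : h1Norm g (0 : M → ℝ) = 0 := by
  have hc : ContMDiff (𝓡 n) 𝓘(ℝ, ℝ) ∞ (0 : M → ℝ) := contMDiff_const
  refine le_antisymm (h1Norm_le (isWeakDifferential_differential hc) (le_of_eq ?_)) zero_le
  have h0 : ∀ x, coNorm g x (differential (0 : M → ℝ) x) = 0 := by
    intro x
    have : differential (n := n) (0 : M → ℝ) x = 0 := mfderiv_const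
    simp [coNorm, this]
  simp [h1Energy, h0]

variable [BorelSpace M]

/-- The triangle inequality for the `H¹` norm, for two functions of norm less than `δ`. -/
theorem h1Norm_add_le_of_lt (hu : AEMeasurable u (vol g)) {δ : ℝ≥0∞} (h1 : h1Norm g u < δ)
    (h2 : h1Norm g v < δ) : h1Norm g (u + v) ≤ 2 * δ := by
  obtain ⟨α, hα, hαE⟩ := exists_h1Energy_le_of_h1Norm_lt h1
  obtain ⟨β, hβ, hβE⟩ := exists_h1Energy_le_of_h1Norm_lt h2
  refine h1Norm_le (hα.add hβ) ?_
  have e1 : ∫⁻ x, ‖(u + v) x‖ₑ ^ 2 ∂(vol g) ≤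
      2 * (∫⁻ x, ‖u x‖ₑ ^ 2 ∂(vol g) + ∫⁻ x, ‖v x‖ₑ ^ 2 ∂(vol g)) := by
    rw [← lintegral_add_left' (hu.enorm.pow_const 2), ← lintegral_const_mul' _ _ (by simp)]
    refine lintegral_mono fun x => (pow_le_pow_left₀ zero_le (enorm_add_le _ _) 2).trans ?_
    exact ennreal_add_sq_le _ _
  have e2 : ∫⁻ x, coNorm g x (α x + β x) ^ 2 ∂(vol g) ≤
      2 * (∫⁻ x, coNorm g x (α x) ^ 2 ∂(vol g) + ∫⁻ x, coNorm g x (β x) ^ 2 ∂(vol g)) := by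
    rw [← lintegral_add_left' ((hα.aemeasurable_coNorm g).pow_const 2),
      ← lintegral_const_mul' _ _ (by simp)]
    refine lintegral_mono fun x => (pow_le_pow_left₀ zero_le (coNorm_add_le g x _ _) 2).trans ?_
    exact ennreal_add_sq_le _ _
  calc h1Energy g (u + v) (fun x => α x + β x)
      ≤ 2 * (h1Energy g u α + h1Energy g v β) := by
        refine (add_le_add e1 e2).trans (le_of_eq ?_)
        simp only [h1Energy]
        ring
    _ ≤ 2 * (δ ^ 2 + δ ^ 2) := by gcongr
    _ = (2 * δ) ^ 2 := by ring

theorem h1Norm_le_of_ae_eq (h : u =ᵐ[vol g] v) : h1Norm g v ≤ h1Norm g u := by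
  refine le_iInf₂ fun α hα => ?_
  refine (iInf₂_le α (hα.congr fun e he => ae_chart_of_ae_vol g he h)).trans (le_of_eq ?_)
  have : ∫⁻ x, ‖v x‖ₑ ^ 2 ∂(vol g) = ∫⁻ x, ‖u x‖ₑ ^ 2 ∂(vol g) := by
    refine lintegral_congr_ae ?_
    filter_upwards [h] with x hx
    rw [hx]
  rw [this]

theorem memLp_of_contMDiff (g : Metric n M) {φ : M → ℝ} (hφ : ContMDiff (𝓡 n) 𝓘(ℝ, ℝ) ∞ φ) :
    MemLp φ 2 (vol g) := by
  have := isFiniteMeasure_vol g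
  obtain ⟨C, hC⟩ := isCompact_univ.exists_bound_of_continuousOn hφ.continuous.continuousOn
  exact MemLp.of_bound hφ.continuous.measurable.aestronglyMeasurable C
    (Filter.Eventually.of_forall fun x => hC x (mem_univ x))

theorem mem_H1_of_contMDiff (g : Metric n M) {φ : M → ℝ}
    (hφ : ContMDiff (𝓡 n) 𝓘(ℝ, ℝ) ∞ φ) : φ ∈ H1 g := by
  have := isFiniteMeasure_vol g
  refine ⟨⟨memLp_of_contMDiff g hφ, differential φ, isWeakDifferential_differential hφ, ?_⟩,
    fun ε hε => ⟨φ, hφ, by rwa [sub_self, h1Norm_zero]⟩⟩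
  obtain ⟨C, hC⟩ := exists_coNorm_differential_le g hφ
  calc ∫⁻ x, coNorm g x (differential φ x) ^ 2 ∂(vol g)
      ≤ ∫⁻ _, (C : ℝ≥0∞) ^ 2 ∂(vol g) := lintegral_mono fun x => by
        gcongr
        exact hC x
    _ < ⊤ := by
      rw [lintegral_const]
      exact ENNReal.mul_lt_top (by simp) (measure_lt_top _ _)

/-! ### Cutting off near a compact set -/

theorem testFunctions_subset_vanishingNear (g : Metric n M) (A : Set M) :
    testFunctions n A ⊆ vanishingNear g A := by
  rintro φ ⟨hφ, -, hs⟩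
  refine ⟨mem_H1_of_contMDiff g hφ, (tsupport φ)ᶜ, (isClosed_tsupport φ).isOpen_compl,
    subset_compl_comm.1 hs, Filter.Eventually.of_forall fun x hx => ?_⟩
  exact image_eq_zero_of_notMem_tsupport hx

/-- A function of `H¹` that vanishes near the compact set `A` is a limit of test functions on the
complement of `A`: cut its smooth approximations off near `A`. -/
theorem exists_testFunction_h1Norm_sub_lt {A : Set M} (hA : IsCompact A)
    (hu : u ∈ vanishingNear g A) {δ : ℝ≥0∞} (hδ : 0 < δ) :
    ∃ φ ∈ testFunctions n A, h1Norm g (u - φ) < δ := by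
  obtain ⟨hu1, U, hU, hAU, hu0⟩ := hu
  obtain ⟨η, hη0, hη1, -⟩ := exists_contMDiffMap_zero_one_nhds_of_isClosed (𝓡 n) (n := ⊤)
    hA.isClosed hU.isClosed_compl (disjoint_compl_right_iff_subset.2 hAU)
  have hη : ContMDiff (𝓡 n) 𝓘(ℝ, ℝ) ∞ η := η.contMDiff
  obtain ⟨K, hK⟩ := exists_h1Norm_smooth_mul_le g hη
  obtain ⟨ε, hε, hεK⟩ := ENNReal.exists_nnreal_pos_mul_lt (a := K) (by simp) hδ.ne'
  obtain ⟨φ, hφ, hφε⟩ := hu1.2 ε (by exact_mod_cast hε)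
  refine ⟨η * φ, ⟨hη.mul hφ, HasCompactSupport.of_compactSpace _, ?_⟩, ?_⟩
  · -- near a point of `A` the cutoff vanishes identically
    intro x hx hxA
    have hev : ∀ᶠ z in nhds x, η z = 0 := (eventually_nhdsSet_iff_forall.1 hη0) x hxA
    exact (notMem_tsupport_iff_eventuallyEq.2 hev) (tsupport_mul_subset_left hx)
  · have hm : AEMeasurable (u - φ) (vol g) :=
      hu1.1.1.aestronglyMeasurable.aemeasurable.sub hφ.continuous.measurable.aemeasurable
    have hae : (η * (u - φ) : M → ℝ) =ᵐ[vol g] u - η * φ := by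
      filter_upwards [hu0] with x hx
      simp only [Pi.mul_apply, Pi.sub_apply]
      by_cases hxU : x ∈ U
      · simp [hx hxU]
      · have : η x = 1 := (hη1.self_of_nhdsSet) x hxU
        simp [this]
    refine (h1Norm_le_of_ae_eq hae).trans_lt (lt_of_le_of_lt (hK _ hm _ hφε) ?_)
    rwa [mul_comm]

theorem H10_subset_usualH10 (g : Metric n M) {A : Set M} (hA : IsCompact A) :
    H10 g A ⊆ usualH10 g A := by
  refine fun u hu => ⟨hu.1, fun ε hε => ?_⟩
  obtain ⟨δ, hδ, hδε⟩ := ENNReal.exists_nnreal_pos_mul_lt (a := 2) (by simp) hε.ne'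
  have hδ' : (0 : ℝ≥0∞) < δ := by exact_mod_cast hδ
  obtain ⟨s, hs, hus⟩ := hu.2 δ hδ'
  obtain ⟨φ, hφ, hsφ⟩ := exists_testFunction_h1Norm_sub_lt hA hs hδ'
  refine ⟨φ, hφ, ?_⟩
  have hm : AEMeasurable (u - s) (vol g) :=
    hu.1.1.1.aestronglyMeasurable.aemeasurable.sub hs.1.1.1.aestronglyMeasurable.aemeasurable
  have h := h1Norm_add_le_of_lt hm hus hsφ
  rw [sub_add_sub_cancel] at h
  exact h.trans_lt (by rwa [mul_comm])

end H1Norm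

end SobolevHoles

theorem mainTheorem5 {n : ℕ} {M : Type*} [TopologicalSpace M]
    [ChartedSpace (EuclideanSpace ℝ (Fin n)) M] [IsManifold (𝓡 n) ∞ M]
    [T2Space M] [CompactSpace M] [MeasurableSpace M] [BorelSpace M]
    (g : SobolevHoles.Metric n M) (A : Set M) (hA : IsCompact A) :
    SobolevHoles.H10 g A = SobolevHoles.usualH10 g A :=
  Subset.antisymm (SobolevHoles.H10_subset_usualH10 g hA)
    (SobolevHoles.closureH1_mono g (SobolevHoles.testFunctions_subset_vanishingNear g A))
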